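/- Let $\mathbb F_q$ be a finite field and let $G=(V,E)$ be a simple graph. Each vertex $i\in V$ is a server and each edge $e\in E$ is a file $W_e$, stored on exactly the two servers that are the endpoints of $e$. The files are independent and uniformly distributed on $\mathbb F_q^L$, where $L\ge 1$ is the subpacketization; the $L$ coordinates of a file are its sub-files. Write $\mathcal W_{S_i}$ for the collection of files stored on server $i$. A (linear) PIR scheme on $G$ consists of a choice of $L$ and, for every desired file $\theta\in E$, a random tuple of queries $\mathcal Q=(Q_i)_{i\in V}$, independent of the files, where $Q_i$ is a list of $\mathbb F_q$-linear combinations of sub-files of the files stored on server $i$, of a length depending only on $i$ (zero combinations are allowed). The answer $A_i$ of server $i$ is the list of the values of these combinations. With entropies taken to base $q$, two conditions are required: - (reliability) $H(W_\theta\mid (A_i)_{i\in V},\mathcal Q)=0$ for every $\theta\in E$; - (privacy) for every $i\in V$ the joint law of $(Q_i,A_i,\mathcal W_{S_i})$ is the same for all $\theta\in E$. The rate of a PIR scheme $\Pi$ is $R(\Pi)=L/\sum_{i\in V}H(A_i)$ (by privacy this does not depend on $\theta$), and the PIR capacity of $G$ is $\mathcal C(G)=\sup_\Pi R(\Pi)$,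 the supremum over all PIR schemes on $G$. **Theorem.** There is a sequence of real numbers $(\varepsilon_N)$ with $\varepsilon_N\to 0$ as $N\to\infty$ such that, for every integer $N\ge 3$ and every finite field $\mathbb F_q$, the PIR capacity of the complete graph $K_N$ satisfies $$\mathcal C(K_N)\ \ge\ \Bigl(\frac43-\varepsilon_N\Bigr)\cdot\frac1N .$$ -/

import Mathlib

open scoped ENNReal

noncomputable section

/-- The Shannon entropy, in base `b`, of a law `p` on a finite set:
`H(p) = - ∑ₐ p(a) log_b p(a)`, with `0 log 0 = 0`. -/
def shannonEntropy (b : ℝ) {α : Type*} [Fintype α] (p : PMF α) : ℝ :=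
  -∑ a, (p a).toReal * Real.logb b (p a).toReal

/-- The entropy `H(X)` of a random variable `X` defined on the probability space `(Ω, p)`. -/
def entropyOf (b : ℝ) {Ω α : Type*} [Fintype α] (p : PMF Ω) (X : Ω → α) : ℝ :=
  shannonEntropy b (p.map X)

/-- The conditional entropy of `X` given `Y`, for random variables `X`, `Y` on `(Ω, p)`:
`H(X | Y) = - ∑ P(X = x, Y = y) log_b (P(X = x, Y = y) / P(Y = y))`, with `0 log 0 = 0`. -/
def condEntropyOf (b : ℝ) {Ω α β : Type*} [Fintype α] [Fintype β] (p : PMF Ω)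
    (X : Ω → α) (Y : Ω → β) : ℝ :=
  -∑ x, ∑ y, (p.map (fun ω => (X ω, Y ω)) (x, y)).toReal *
    Real.logb b ((p.map (fun ω => (X ω, Y ω)) (x, y)).toReal / (p.map Y y).toReal)

namespace GraphPIR

variable {V : Type*} [Fintype V] [DecidableEq V] (G : SimpleGraph V) [DecidableRel G.Adj]
variable (F : Type*) [Field F] [Fintype F]

/-- The files are indexed by the edges of `G`; server `i` stores those of its incident edges. -/
abbrev StoredFile (i : V) : Type _ := {e : G.edgeSet // i ∈ (e : Sym2 V)}

/-- The contents of all files, each one consisting of `L` sub-files, which are symbols of `F`. -/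
abbrev Contents (L : ℕ) : Type _ := G.edgeSet → Fin L → F

/-- The contents of the files that are stored on server `i`. -/
abbrev StoredContents (L : ℕ) (i : V) : Type _ := StoredFile G i → Fin L → F

/-- A query to server `i`: a list of `m` linear combinations of sub-files stored on server `i`,
given by their coefficients (a combination may be zero). -/
abbrev Query (L m : ℕ) (i : V) : Type _ := Fin m → StoredFile G i → Fin L → F

/-- A (not yet reliable or private) retrieval protocol on the storage system of `G`. For every
desired file `θ` it gives the joint law of the queries to the servers, generated by the user's
private randomness. -/
structure Scheme where
  /-- the subpacketization level -/
  L : ℕ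
  L_pos : 0 < L
  /-- the number of symbols that each server sends -/
  numSums : V → ℕ
  /-- the joint law of the queries when the desired file is `θ` -/
  queryLaw : G.edgeSet → PMF (∀ i, Query G F L (numSums i) i)

namespace Scheme

variable {G F}
variable (S : Scheme G F)

/-- The sample space: queries to all servers, and contents of all files. -/
abbrev Sample : Type _ := (∀ i, Query G F S.L (S.numSums i) i) × Contents G F S.L

/-- The joint law of queries and files when the desired file is `θ`: the files are independent and
uniformly distributed, so that each has entropy `L`, and they are independent of the queries. -/
def law (θ : G.edgeSet) : PMF S.Sample :=
  (S.queryLaw θ).bind fun Q =>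
    (PMF.uniformOfFintype (Contents G F S.L)).map fun W => (Q, W)

/-- The family `𝒬` of all queries. -/
def queries (ω : S.Sample) : ∀ i, Query G F S.L (S.numSums i) i := ω.1

/-- The file `W_e`. -/
def file (e : G.edgeSet) (ω : S.Sample) : Fin S.L → F := ω.2 e

/-- The collection of the files that are stored on server `i`. -/
def stored (i : V) (ω : S.Sample) : StoredContents G F S.L i := fun e => ω.2 e.1

/-- The answer `A_i`: the values of the requested linear combinations. It is a function of the
query to server `i` and of the files stored on server `i`. -/
def answer (i : V) (ω : S.Sample) : Fin (S.numSums i) → F := fun r =>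
  ∑ e : StoredFile G i, ∑ l : Fin S.L, S.queries ω i r e l * S.stored i ω e l

/-- The family of all answers. -/
def answers (ω : S.Sample) : ∀ i, Fin (S.numSums i) → F := fun i => S.answer i ω

/-- Entropies are measured in symbols of `F`, that is, in base `|F|`. -/
def base (_S : Scheme G F) : ℝ := (Fintype.card F : ℝ)

/-- Reliability: `H(W_θ | A_{[N]}, 𝒬) = 0` for every desired file `θ`. -/
def Reliable : Prop :=
  ∀ θ : G.edgeSet,
    condEntropyOf S.base (S.law θ) (S.file θ) (fun ω => (S.answers ω, S.queries ω)) = 0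

/-- Privacy: for every server `i`, the joint law of the query to `i`, of its answer, and of the
files stored on it, does not depend on the desired file. -/
def Private : Prop :=
  ∀ (i : V) (θ θ' : G.edgeSet),
    (S.law θ).map (fun ω => (S.queries ω i, S.answer i ω, S.stored i ω)) =
      (S.law θ').map (fun ω => (S.queries ω i, S.answer i ω, S.stored i ω))

/-- A PIR scheme is a reliable and private protocol. -/
structure IsPIR : Prop where
  reliable : S.Reliable
  isPrivate : S.Private

/-- The retrieval rate `L / ∑ᵢ H(A_i)` when the desired file is `θ`. For a private protocol it does
not depend on `θ`. -/
def rate (θ : G.edgeSet) : ℝ :=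
  (S.L : ℝ) / ∑ i, entropyOf S.base (S.law θ) (S.answer i)

end Scheme

/-- The PIR capacity of `G` for files over `F`: the supremum of the rates of all PIR schemes, taken
in the extended reals (so that no boundedness is presupposed). The rate of a PIR scheme is the same
for all desired files; the infimum over `θ` is this common value. -/
def capacity : EReal :=
  ⨆ (S : Scheme G F) (_ : S.IsPIR), ⨅ θ : G.edgeSet, (S.rate θ : EReal)

end GraphPIR

end

/-! The bound holds with error zero. To retrieve the file on `uv`, contract `uv` to one vertex and
give every vertex a uniform variable in `Fin 4` and every edge one in `Fin 9`. A server off `uv` is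
used when its variable is nonzero (probability 3/4); an edge between two such servers is asked about
when both vertex variables and the edge variable are nonzero. The contracted vertex's variable is a
coin shared by `u` and `v`: 0 silences `u`, 1 silences `v`, and it always selects exactly one of
them to be asked about `uv`. Privacy: every server is used with probability 3/4, and is then asked
about each of its edges independently with probability 3/4 · 8/9 = 2/3, whatever the desired edge is
(`map_view_apply`). Reliability: any other file is asked of both its servers or of neither
(`asks_comm`), so with opposite signs at the two ends it cancels in the sum of all answers, while
the desired file occurs once (`asks_endpoint_iff`). Rate: an unused server answers zero, so an
answer has entropy at most 3L/4 + 2 (`entropyOf_answer_le`); let L tend to infinity. -/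

/-! ### Entropy estimates -/

theorem PMF.sum_toReal {α : Type*} [Fintype α] (p : PMF α) : ∑ a, (p a).toReal = 1 := by
  rw [← ENNReal.toReal_sum fun a _ => p.apply_ne_top a, ← tsum_fintype (L := .unconditional _),
    p.tsum_coe, ENNReal.toReal_one]

theorem PMF.toReal_apply_le_one {α : Type*} (p : PMF α) (a : α) : (p a).toReal ≤ 1 := by
  simpa using ENNReal.toReal_mono ENNReal.one_ne_top (p.coe_le_one a)

/-- Reweighting form of the bound `log x ≤ x - 1`. -/
theorem neg_mul_log_le {x M : ℝ} (hx : 0 ≤ x) (hM : 0 < M) :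
    -(x * Real.log x) ≤ x * Real.log M + M⁻¹ - x := by
  rcases hx.eq_or_lt with rfl | hx
  · simp [hM.le]
  have h := Real.log_le_sub_one_of_pos (x := (M * x)⁻¹) (by positivity)
  rw [Real.log_inv, Real.log_mul hM.ne' hx.ne'] at h
  have h2 := mul_le_mul_of_nonneg_left h hx.le
  have h3 : x * ((M * x)⁻¹ - 1) = M⁻¹ - x := by field_simp
  linarith

/-- An atom of mass `p z` cannot contribute to the leading term of the entropy. -/
theorem shannonEntropy_le {b : ℝ} (hb : 1 < b) {α : Type*} [Fintype α] (p : PMF α) (z : α) :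
    shannonEntropy b p ≤
      ((1 - (p z).toReal) * Real.log (Fintype.card α) + 1) / Real.log b := by
  classical
  have : Nonempty α := ⟨z⟩
  have hM : (0 : ℝ) < Fintype.card α := by exact_mod_cast Fintype.card_pos
  have hsum := p.sum_toReal
  rw [← Finset.add_sum_erase _ _ (Finset.mem_univ z)] at hsum
  -- The atom `z` is compared with `M = 1`, the others with `M = |α|`, so only the mass off `z` is
  -- charged `log |α|`.
  have hz : -((p z).toReal * Real.log (p z).toReal) ≤ 1 - (p z).toReal := by
    simpa using neg_mul_log_le (x := (p z).toReal) ENNReal.toReal_nonneg one_pos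
  have hrest : ∑ a ∈ Finset.univ.erase z, -((p a).toReal * Real.log (p a).toReal) ≤
      ∑ a ∈ Finset.univ.erase z, ((p a).toReal * Real.log (Fintype.card α) +
        (Fintype.card α : ℝ)⁻¹ - (p a).toReal) :=
    Finset.sum_le_sum fun a _ => neg_mul_log_le ENNReal.toReal_nonneg hM
  have hcard : ∑ _a ∈ Finset.univ.erase z, (Fintype.card α : ℝ)⁻¹ ≤ 1 := by
    calc _ ≤ ∑ _a : α, (Fintype.card α : ℝ)⁻¹ :=
          Finset.sum_le_sum_of_subset_of_nonneg (Finset.erase_subset _ _)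
            fun _ _ _ => by positivity
      _ = 1 := by simp [hM.ne']
  rw [Finset.sum_sub_distrib, Finset.sum_add_distrib, ← Finset.sum_mul] at hrest
  have hmain : shannonEntropy b p =
      (∑ a, -((p a).toReal * Real.log (p a).toReal)) / Real.log b := by
    simp only [shannonEntropy, Real.logb, Finset.sum_neg_distrib, neg_div, Finset.sum_div,
      mul_div_assoc]
  rw [hmain]
  refine div_le_div_of_nonneg_right ?_ (Real.log_pos hb).le
  rw [← Finset.add_sum_erase _ _ (Finset.mem_univ z),
    show 1 - (p z).toReal = ∑ a ∈ Finset.univ.erase z, (p a).toReal by linarith]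
  linarith

theorem neg_mul_logb_nonneg {b : ℝ} (hb : 1 < b) {α : Type*} (p : PMF α) (a : α) :
    0 ≤ -((p a).toReal * Real.logb b (p a).toReal) := by
  rw [neg_nonneg]
  exact mul_nonpos_of_nonneg_of_nonpos ENNReal.toReal_nonneg
    (Real.logb_nonpos hb ENNReal.toReal_nonneg (p.toReal_apply_le_one a))

theorem shannonEntropy_nonneg {b : ℝ} (hb : 1 < b) {α : Type*} [Fintype α] (p : PMF α) :
    0 ≤ shannonEntropy b p := by
  rw [shannonEntropy, ← Finset.sum_neg_distrib]
  exact Finset.sum_nonneg fun a _ => neg_mul_logb_nonneg hb p a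

theorem shannonEntropy_pos {b : ℝ} (hb : 1 < b) {α : Type*} [Fintype α] (p : PMF α) {a a' : α}
    (hne : a ≠ a') (ha : a ∈ p.support) (ha' : a' ∈ p.support) : 0 < shannonEntropy b p := by
  classical
  have pos : ∀ c ∈ p.support, 0 < (p c).toReal := fun c hc =>
    ENNReal.toReal_pos ((p.mem_support_iff c).1 hc) (p.apply_ne_top c)
  have hlt : (p a).toReal < 1 := by
    have h : (p a).toReal + (p a').toReal ≤ 1 := by
      rw [← p.sum_toReal, ← Finset.sum_pair (f := fun c => (p c).toReal) hne]
      exact Finset.sum_le_sum_of_subset_of_nonneg (Finset.subset_univ _)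
        fun _ _ _ => ENNReal.toReal_nonneg
    linarith [pos a' ha']
  rw [shannonEntropy, ← Finset.sum_neg_distrib]
  refine Finset.sum_pos' (fun c _ => neg_mul_logb_nonneg hb p c) ⟨a, Finset.mem_univ a, ?_⟩
  rw [neg_pos]
  exact mul_neg_of_pos_of_neg (pos a ha) (Real.logb_neg hb (pos a ha) hlt)

/-- A variable that is determined by `Y` almost surely has no entropy given `Y`. -/
theorem condEntropyOf_eq_zero (b : ℝ) {Ω α β : Type*} [Fintype α] [Fintype β] (p : PMF Ω)
    (X : Ω → α) (Y : Ω → β)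
    (h : ∀ ω ∈ p.support, ∀ ω' ∈ p.support, Y ω = Y ω' → X ω = X ω') :
    condEntropyOf b p X Y = 0 := by
  rw [condEntropyOf, neg_eq_zero]
  refine Finset.sum_eq_zero fun x _ => Finset.sum_eq_zero fun y _ => ?_
  by_cases h0 : p.map (fun ω => (X ω, Y ω)) (x, y) = 0
  · simp [h0]
  obtain ⟨ω₀, hω₀, hxy⟩ := (PMF.mem_support_map_iff _ _ _).1 ((PMF.mem_support_iff _ _).2 h0)
  obtain ⟨rfl, rfl⟩ := Prod.ext_iff.1 hxy
  -- On an attained value, `Y` already fixes `X`, so joint and marginal masses agree and the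
  -- logarithm is that of 1.
  have heq : p.map (fun ω => (X ω, Y ω)) (X ω₀, Y ω₀) = p.map Y (Y ω₀) := by
    classical
    rw [PMF.map_apply, PMF.map_apply]
    refine tsum_congr fun ω => ?_
    by_cases hω : ω ∈ p.support
    · by_cases hY : Y ω₀ = Y ω
      · simp [hY, h ω₀ hω₀ ω hω hY]
      · simp [hY]
    · simp [(PMF.apply_eq_zero_iff p ω).2 hω]
  dsimp only at h0
  rw [heq] at h0 ⊢
  rw [div_self (ENNReal.toReal_ne_zero.2 ⟨h0, PMF.apply_ne_top _ _⟩)]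
  simp

/-! ### Images of uniform laws -/

theorem PMF.map_uniformOfFintype_apply {α β : Type*} [Fintype α] [Nonempty α] [DecidableEq β]
    (f : α → β) (b : β) :
    (PMF.uniformOfFintype α).map f b =
      (Finset.univ.filter fun a => f a = b).card / (Fintype.card α : ℝ≥0∞) := by
  simp only [PMF.map_apply, PMF.uniformOfFintype_apply, tsum_fintype]
  rw [Finset.sum_ite, Finset.sum_const_zero, add_zero, Finset.sum_const, nsmul_eq_mul,
    div_eq_mul_inv]
  simp only [eq_comm]

/-- The fibres are cosets of the kernel, hence equally large. -/
theorem PMF.map_uniformOfFintype_addMonoidHom {A B : Type*} [AddGroup A] [AddGroup B] [Fintype A]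
    [Fintype B] (f : A →+ B) (hf : Function.Surjective f) :
    (PMF.uniformOfFintype A).map f = PMF.uniformOfFintype B := by
  classical
  have hconst : ∀ b, (PMF.uniformOfFintype A).map f b = (PMF.uniformOfFintype A).map f 0 := by
    intro b
    rw [PMF.map_uniformOfFintype_apply, PMF.map_uniformOfFintype_apply,
      AddMonoidHom.card_fiber_eq_of_mem_range f (x := b) (y := 0) (hf b) (hf 0)]
  have hsum := ((PMF.uniformOfFintype A).map f).tsum_coe
  simp only [hconst, tsum_fintype, Finset.sum_const, nsmul_eq_mul, Finset.card_univ] at hsum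
  ext b
  rw [hconst, PMF.uniformOfFintype_apply]
  exact ENNReal.eq_inv_of_mul_eq_one_left (by rw [mul_comm]; exact hsum)

namespace GraphPIR

/-! ### Random views by contraction of the desired edge -/

section View

variable {V : Type*}

/-- The user's randomness. The vertex `none` stands for the contracted desired edge. -/
abbrev Seed (V : Type*) : Type _ := (Option V → Fin 4) × (Sym2 (Option V) → Fin 9)

/-- The image of a vertex after contraction of the edge `uv`. -/
def contract [DecidableEq V] (u v i : V) : Option V := if i = u ∨ i = v then none else some i

/-- The part of the randomness that is visible from the vertex `k`. -/
def localSeed (k : Option V) : Seed V →+ (Option V → Fin 4 × Fin 9) where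
  toFun ω k' := (ω.1 k', ω.2 s(k, k'))
  map_zero' := rfl
  map_add' _ _ := rfl

theorem localSeed_surjective (k : Option V) : Function.Surjective (localSeed k) := by
  intro w
  have hinj : Function.Injective fun k' : Option V => s(k, k') := fun a b h => Sym2.congr_right.1 h
  refine ⟨(fun k' => (w k').1, Function.extend (fun k' => s(k, k')) (fun k' => (w k').2) 0), ?_⟩
  funext k'
  exact Prod.ext rfl (hinj.extend_apply (fun k' => (w k').2) 0 k')

variable [DecidableEq V]

/-- The neighbours that the endpoint `i` of the desired edge `iv` is asked about; `none` if the
server is not used. The edge `iv` itself is decided by the shared coin. -/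
def endpointView (A B : Finset (Fin 4)) (i v : V) (w : Option V → Fin 4 × Fin 9) :
    Option (V → Bool) :=
  if (w none).1 ∈ A then
    some fun j => decide (j ≠ i ∧ if j = v then (w none).1 ∈ B
      else (w (some j)).1 ≠ 0 ∧ (w (some j)).2 ≠ 0)
  else none

/-- The neighbours that a server `i` off the desired edge `uv` is asked about; `none` if the
server is not used. -/
def outsideView (u v i : V) (w : Option V → Fin 4 × Fin 9) : Option (V → Bool) :=
  if (w (some i)).1 ≠ 0 then
    some fun j => decide (j ≠ i ∧
      -- Both edges to the contracted vertex share one edge variable; only the excluded coin value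
      -- differs.
      if j = u then (w none).1 ≠ 0 ∧ (w none).2 ≠ 0
      else if j = v then (w none).1 ≠ 1 ∧ (w none).2 ≠ 0
      else (w (some j)).1 ≠ 0 ∧ (w (some j)).2 ≠ 0)
  else none

/-- The neighbours that server `i` is asked about when the desired edge is `uv`. -/
def view (u v i : V) (ω : Seed V) : Option (V → Bool) :=
  let w := localSeed (contract u v i) ω
  -- Each endpoint is used for three coin values and asked about `uv` for two of them; those two
  -- pairs partition `Fin 4`.
  if i = u then endpointView {1, 2, 3} {1, 2} u v w
  else if i = v then endpointView {0, 2, 3} {0, 3} v u w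
  else outsideView u v i w

/-- Server `i` is asked about its edge to `j`. -/
def asks (u v : V) (ω : Seed V) (i j : V) : Prop := ∃ T, view u v i ω = some T ∧ T j = true

theorem asks_of_endpoint_left {u v : V} (ω : Seed V) (j : V) :
    asks u v ω u j ↔ ω.1 none ≠ 0 ∧ j ≠ u ∧ if j = v then ω.1 none = 1 ∨ ω.1 none = 2
      else ω.1 (some j) ≠ 0 ∧ ω.2 s(none, some j) ≠ 0 := by
  have : ω.1 none ∈ ({1, 2, 3} : Finset (Fin 4)) ↔ ω.1 none ≠ 0 := by
    generalize ω.1 none = c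
    revert c
    decide
  have h2 : ω.1 none ∈ ({1, 2} : Finset (Fin 4)) ↔ ω.1 none = 1 ∨ ω.1 none = 2 := by simp
  simp [asks, view, endpointView, localSeed, contract, -Finset.mem_insert, this, h2]

theorem asks_of_endpoint_right {u v : V} (huv : u ≠ v) (ω : Seed V) (j : V) :
    asks u v ω v j ↔ ω.1 none ≠ 1 ∧ j ≠ v ∧ if j = u then ω.1 none = 0 ∨ ω.1 none = 3
      else ω.1 (some j) ≠ 0 ∧ ω.2 s(none, some j) ≠ 0 := by
  have : ω.1 none ∈ ({0, 2, 3} : Finset (Fin 4)) ↔ ω.1 none ≠ 1 := by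
    generalize ω.1 none = c
    revert c
    decide
  have h2 : ω.1 none ∈ ({0, 3} : Finset (Fin 4)) ↔ ω.1 none = 0 ∨ ω.1 none = 3 := by simp
  simp [asks, view, endpointView, localSeed, contract, huv.symm, -Finset.mem_insert, this, h2]

theorem asks_of_outside {u v i : V} (hu : i ≠ u) (hv : i ≠ v) (ω : Seed V) (j : V) :
    asks u v ω i j ↔ ω.1 (some i) ≠ 0 ∧ j ≠ i ∧
      if j = u then ω.1 none ≠ 0 ∧ ω.2 s(some i, none) ≠ 0
      else if j = v then ω.1 none ≠ 1 ∧ ω.2 s(some i, none) ≠ 0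
      else ω.1 (some j) ≠ 0 ∧ ω.2 s(some i, some j) ≠ 0 := by
  simp [asks, view, outsideView, localSeed, contract, hu, hv]

/-- Off the desired edge, the two servers that store a file are asked about it simultaneously. -/
theorem asks_comm {u v : V} (huv : u ≠ v) (ω : Seed V) {i j : V} (hij : i ≠ j)
    (he : s(i, j) ≠ s(u, v)) : asks u v ω i j ↔ asks u v ω j i := by
  have hswap : ∀ a b : Option V, ω.2 s(a, b) = ω.2 s(b, a) := fun a b => by rw [Sym2.eq_swap]
  wlog hu : i ≠ u ∧ i ≠ v generalizing i j with H
  · by_cases hj : j ≠ u ∧ j ≠ v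
    · exact (H hij.symm (by rwa [Sym2.eq_swap]) hj).symm
    · have hi' : i = u ∨ i = v := by tauto
      have hj' : j = u ∨ j = v := by tauto
      -- With both ends in `{u, v}`, the edge would be a loop or `uv` itself.
      rcases hi' with rfl | rfl <;> rcases hj' with rfl | rfl <;> simp_all [Sym2.eq_swap]
  rw [asks_of_outside hu.1 hu.2]
  by_cases hju : j = u
  · subst hju
    rw [asks_of_endpoint_left, hswap none]
    simp only [hij.symm, hu.1, hu.2, if_true, if_false, ne_eq, not_false_eq_true, true_and]
    tauto
  by_cases hjv : j = v
  · subst hjv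
    rw [asks_of_endpoint_right huv, hswap none]
    simp only [hij.symm, hju, hu.1, hu.2, if_true, if_false, ne_eq, not_false_eq_true, true_and]
    tauto
  · rw [asks_of_outside hju hjv, hswap (some j) (some i)]
    simp only [hij.symm, hju, hjv, hu.1, hu.2, hij, if_false, ne_eq, not_false_eq_true, true_and]
    tauto

/-- Exactly one of the two servers that store the desired file is asked about it. -/
theorem asks_endpoint_iff {u v : V} (huv : u ≠ v) (ω : Seed V) :
    asks u v ω u v ↔ ¬ asks u v ω v u := by
  rw [asks_of_endpoint_left, asks_of_endpoint_right huv]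
  simp only [huv, huv.symm, if_true, ne_eq, not_false_eq_true, true_and]
  generalize ω.1 none = c
  revert c
  decide

/-! ### Counting local seeds: the law of a view -/

variable [Fintype V]

/-- The values of a vertex and an edge variable for which the edge is used, or is not used. -/
def edgeCell (t : Bool) : Finset (Fin 4 × Fin 9) :=
  Finset.univ.filter fun p => decide (p.1 ≠ 0 ∧ p.2 ≠ 0) = t

/-- The number of local seeds that produce a given view of server `i`. -/
def viewCount (i : V) : Option (V → Bool) → ℕ
  -- Out of `36 ^ (|V| + 1)` local seeds, a quarter leave the server unused.
  | none => 9 * 36 * ∏ _j ∈ Finset.univ.erase i, 36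
  -- The fraction 27/36 = 3/4 for a used server, then 24/36 or 12/36 per neighbour; a server is
  -- never asked about itself.
  | some T => if T i then 0 else 36 * 27 * ∏ j ∈ Finset.univ.erase i, (edgeCell (T j)).card

theorem card_edgeCell_true : (edgeCell true).card = 24 := by decide

theorem card_edgeCell_false : (edgeCell false).card = 12 := by decide

/-- Each view is a box condition on the local seed, so counting it reduces to a product over
coordinates. -/
theorem card_filter_forall_mem (i : V) (E : Option V → Finset (Fin 4 × Fin 9))
    (P : (Option V → Fin 4 × Fin 9) → Prop) [DecidablePred P]
    (h : ∀ w, P w ↔ w none ∈ E none ∧ ∀ j, w (some j) ∈ E (some j)) :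
    (Finset.univ.filter P).card = (E none).card *
      ((E (some i)).card * ∏ j ∈ Finset.univ.erase i, (E (some j)).card) := by
  have : Finset.univ.filter P = Fintype.piFinset E := by
    ext w
    simp [Fintype.mem_piFinset, Option.forall, h]
  rw [this, Fintype.card_piFinset, Fintype.prod_option,
    Finset.mul_prod_erase _ (fun j => (E (some j)).card) (Finset.mem_univ i)]

theorem card_endpointView {A B : Finset (Fin 4)} (hA : A.card = 3) (hB : (A ∩ B).card = 2)
    {i v : V} (hiv : i ≠ v) (o : Option (V → Bool)) :
    (Finset.univ.filter fun w => endpointView A B i v w = o).card = viewCount i o := by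
  have hv : v ∈ Finset.univ.erase i := by simp [hiv.symm]
  rcases o with _ | T
  · rw [card_filter_forall_mem i (fun k => k.elim (Aᶜ ×ˢ Finset.univ) fun _ => Finset.univ)]
    · simp [viewCount, Finset.card_compl, hA]; ring
    · intro w
      simp [endpointView]
  · by_cases hT : T i = true
    · rw [viewCount, if_pos hT, Finset.card_eq_zero, Finset.filter_eq_empty_iff]
      intro w _ hw
      simp only [endpointView] at hw
      split_ifs at hw
      have := congrFun (Option.some.inj hw) i
      simp [hT] at this
    -- The coin settles both use of the server and the entry at `v`; the coordinates at `i` and `v`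
    -- are free.
    · rw [card_filter_forall_mem i (fun k => k.elim
        ((if T v then A ∩ B else A \ B) ×ˢ Finset.univ)
        fun j => if j = i ∨ j = v then Finset.univ else edgeCell (T j))]
      · have hrest : ∏ j ∈ (Finset.univ.erase i).erase v,
            (if j = i ∨ j = v then Finset.univ else edgeCell (T j)).card =
            ∏ j ∈ (Finset.univ.erase i).erase v, (edgeCell (T j)).card := by
          refine Finset.prod_congr rfl fun j hj => ?_
          simp only [Finset.mem_erase] at hj
          simp [hj.1, hj.2.1]
        have hd : (A \ B).card = 1 := by
          have := Finset.card_sdiff_add_card_inter A B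
          omega
        simp only [viewCount, if_neg hT, Option.elim]
        rw [← Finset.mul_prod_erase _ _ hv, ← Finset.mul_prod_erase _ _ hv, hrest]
        cases T v
        · simp [hd, card_edgeCell_false]; ring
        · simp [hB, card_edgeCell_true]; ring
      · intro w
        simp only [endpointView]
        constructor
        · intro h
          split_ifs at h with hw
          have h := congrFun (Option.some.inj h)
          refine ⟨?_, fun j => ?_⟩
          · have := h v
            simp only [ne_eq, hiv.symm, not_false_eq_true, if_true, true_and] at this
            cases hTv : T v <;> simp_all
          · simp only [Option.elim]
            split_ifs with hj
            · simp
            · have := h j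
              rw [not_or] at hj
              simpa [hj.1, hj.2, edgeCell] using this
        · rintro ⟨h0, h⟩
          have hw : (w none).1 ∈ A ∧ decide ((w none).1 ∈ B) = T v := by
            cases hTv : T v <;> simp_all
          rw [if_pos hw.1, Option.some_inj]
          funext j
          by_cases hji : j = i
          · simp [hji, hT]
          by_cases hjv : j = v
          · subst hjv
            simpa [hji] using hw.2
          have := h j
          simpa [hji, hjv, edgeCell] using this

theorem card_outsideView {u v i : V} (huv : u ≠ v) (hu : i ≠ u) (hv : i ≠ v)
    (o : Option (V → Bool)) :
    (Finset.univ.filter fun w => outsideView u v i w = o).card = viewCount i o := by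
  have hu' : u ∈ Finset.univ.erase i := by simp [hu.symm]
  have hv' : v ∈ (Finset.univ.erase i).erase u := by simp [hv.symm, huv.symm]
  rcases o with _ | T
  · rw [card_filter_forall_mem i (fun k => k.elim Finset.univ
      fun j => if j = i then Finset.univ.filter fun p => p.1 = 0 else Finset.univ)]
    · rw [Finset.prod_congr (g := fun _ => 36) rfl fun j hj => by simp [Finset.ne_of_mem_erase hj]]
      simp only [viewCount, Option.elim, if_true]
      simp only [← mul_assoc]
      rfl
    · intro w
      simp only [outsideView]
      constructor
      · intro h
        split_ifs at h with hw
        refine ⟨by simp, fun j => ?_⟩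
        by_cases hj : j = i
        · subst hj; simpa using hw
        · simp [hj]
      · rintro ⟨_, h⟩
        simpa using h i
  · by_cases hT : T i = true
    · rw [viewCount, if_pos hT, Finset.card_eq_zero, Finset.filter_eq_empty_iff]
      intro w _ hw
      simp only [outsideView] at hw
      split_ifs at hw
      have := congrFun (Option.some.inj hw) i
      simp [hT] at this
    · rw [card_filter_forall_mem i (fun k => k.elim
        (Finset.univ.filter fun p => decide (p.1 ≠ 0 ∧ p.2 ≠ 0) = T u ∧
          decide (p.1 ≠ 1 ∧ p.2 ≠ 0) = T v)
        fun j => if j = i then ({0}ᶜ : Finset (Fin 4)) ×ˢ Finset.univ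
          else if j = u ∨ j = v then Finset.univ else edgeCell (T j))]
      · have hrest : ∏ j ∈ ((Finset.univ.erase i).erase u).erase v,
            (if j = i then ({0}ᶜ : Finset (Fin 4)) ×ˢ Finset.univ
              else if j = u ∨ j = v then Finset.univ else edgeCell (T j)).card =
            ∏ j ∈ ((Finset.univ.erase i).erase u).erase v, (edgeCell (T j)).card := by
          refine Finset.prod_congr rfl fun j hj => ?_
          simp only [Finset.mem_erase] at hj
          simp [hj.1, hj.2.1, hj.2.2.1]
        have h27 : (({0}ᶜ : Finset (Fin 4)) ×ˢ (Finset.univ : Finset (Fin 9))).card = 27 := by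
          decide
        have h36 : (Finset.univ : Finset (Fin 4 × Fin 9)).card = 36 := by decide
        -- Independence of the entries at `u` and `v`, despite the shared variables: both are asked
        -- with probability 1/2 · 8/9 = (2/3)². This is why the edge variable has nine values.
        have hcell : ∀ t t' : Bool, (Finset.univ.filter fun p : Fin 4 × Fin 9 =>
            decide (p.1 ≠ 0 ∧ p.2 ≠ 0) = t ∧ decide (p.1 ≠ 1 ∧ p.2 ≠ 0) = t').card * 36 =
            (edgeCell t).card * (edgeCell t').card := by decide
        simp only [viewCount, if_neg hT, Option.elim]
        rw [← Finset.mul_prod_erase _ _ hu', ← Finset.mul_prod_erase _ _ hv',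
          ← Finset.mul_prod_erase _ _ hu', ← Finset.mul_prod_erase _ _ hv', hrest]
        simp only [if_true, hu.symm, hv.symm, if_false, true_or, or_true, h27, h36]
        have := hcell (T u) (T v)
        linear_combination (27 * 36 *
          ∏ j ∈ ((Finset.univ.erase i).erase u).erase v, (edgeCell (T j)).card) * this
      · intro w
        simp only [outsideView]
        constructor
        · intro h
          split_ifs at h with hw
          have h := congrFun (Option.some.inj h)
          refine ⟨?_, fun j => ?_⟩
          · have h1 := h u
            have h2 := h v
            simp only [ne_eq, hu.symm, hv.symm, huv.symm, not_false_eq_true, if_true, if_false,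
              true_and] at h1 h2
            simp only [Option.elim, Finset.mem_filter, Finset.mem_univ, true_and]
            exact ⟨h1, h2⟩
          · simp only [Option.elim]
            split_ifs with hj hj'
            · subst hj; simpa using hw
            · simp
            · have := h j
              rw [not_or] at hj'
              simpa [hj, hj'.1, hj'.2, edgeCell] using this
        · rintro ⟨h0, h⟩
          have hw : (w (some i)).1 ≠ 0 := by simpa using h i
          simp only [Option.elim, Finset.mem_filter, Finset.mem_univ, true_and] at h0
          rw [if_pos hw, Option.some_inj]
          funext j
          by_cases hji : j = i
          · simp [hji, hT]
          by_cases hju : j = u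
          · subst hju
            simpa [hji] using h0.1
          by_cases hjv : j = v
          · subst hjv
            simpa [hji, hju] using h0.2
          have := h j
          simpa [hji, hju, hjv, edgeCell] using this

/-- The law of the view of a server does not depend on the desired edge. -/
theorem map_view_apply {u v : V} (huv : u ≠ v) (i : V) (o : Option (V → Bool)) :
    (PMF.uniformOfFintype (Seed V)).map (view u v i) o =
      viewCount i o / (Fintype.card (Option V → Fin 4 × Fin 9) : ℝ≥0∞) := by
  have key : ∀ f : (Option V → Fin 4 × Fin 9) → Option (V → Bool),
      (Finset.univ.filter fun w => f w = o).card = viewCount i o →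
      (PMF.uniformOfFintype (Seed V)).map (fun ω => f (localSeed (contract u v i) ω)) o =
        viewCount i o / (Fintype.card (Option V → Fin 4 × Fin 9) : ℝ≥0∞) := by
    intro f hf
    rw [← hf, ← PMF.map_uniformOfFintype_apply f o,
      ← PMF.map_uniformOfFintype_addMonoidHom _ (localSeed_surjective (contract u v i)),
      PMF.map_comp]
    rfl
  by_cases hu : i = u
  · subst hu
    simpa [view] using key _ (card_endpointView (A := {1, 2, 3}) (B := {1, 2}) (by decide)
      (by decide) huv o)
  by_cases hv : i = v
  · subst hv
    simpa [view, hu] using key _ (card_endpointView (A := {0, 2, 3}) (B := {0, 3}) (by decide)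
      (by decide) huv.symm o)
  simpa [view, hu, hv] using key _ (card_outsideView huv hu hv o)

theorem map_view_none {u v : V} (huv : u ≠ v) (i : V) :
    (PMF.uniformOfFintype (Seed V)).map (view u v i) none = 4⁻¹ := by
  rw [map_view_apply huv]
  have hc : Fintype.card (Option V → Fin 4 × Fin 9) = 4 * viewCount i none := by
    have h := Finset.mul_prod_erase Finset.univ (fun _ : V => 36) (Finset.mem_univ i)
    simp only [Fintype.card_pi, Fintype.card_prod, Fintype.card_fin, Finset.prod_const,
      Finset.card_univ, Fintype.card_option, pow_succ, viewCount] at h ⊢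
    rw [show 4 * 9 = 36 from rfl, ← h]
    ring
  have h0 : (viewCount i none : ℝ≥0∞) ≠ 0 := by
    simp [viewCount, Finset.prod_const]
  rw [hc, Nat.cast_mul, Nat.cast_ofNat, ENNReal.div_eq_inv_mul,
    ENNReal.mul_inv (Or.inl (by norm_num)) (Or.inl (by norm_num)), mul_assoc,
    ENNReal.inv_mul_cancel h0 (ENNReal.natCast_ne_top _), mul_one]

end View

end GraphPIR

set_option linter.unusedSectionVars false

namespace GraphPIR

/-! ### Criteria for privacy, reliability and the rate -/

section Protocol

variable {V : Type*} [Fintype V] [DecidableEq V] {G : SimpleGraph V} [DecidableRel G.Adj]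
variable {F : Type*} [Field F] [Fintype F]

/-- The values of the linear combinations requested by `q`. -/
def evalQuery {L m : ℕ} {i : V} (q : Query G F L m i) (W : Contents G F L) : Fin m → F :=
  fun r => ∑ e : StoredFile G i, ∑ l : Fin L, q r e l * W e.1 l

namespace Scheme

variable (S : Scheme G F)

theorem one_lt_base : 1 < S.base := by
  have h : 1 < Fintype.card F := Fintype.one_lt_card
  rw [base]
  exact_mod_cast h

theorem map_law {γ : Type*} (θ : G.edgeSet) (f : S.Sample → γ) :
    (S.law θ).map f = (S.queryLaw θ).bind fun Q =>
      (PMF.uniformOfFintype (Contents G F S.L)).map fun W => f (Q, W) := by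
  simp only [law, PMF.map_bind, PMF.map_comp]
  rfl

theorem mem_support_law (θ : G.edgeSet) (ω : S.Sample) :
    ω ∈ (S.law θ).support ↔ ω.1 ∈ (S.queryLaw θ).support := by
  simp only [law, PMF.mem_support_bind_iff, PMF.mem_support_map_iff]
  constructor
  · rintro ⟨Q, hQ, W, -, rfl⟩
    exact hQ
  · intro h
    exact ⟨ω.1, h, ω.2, PMF.mem_support_uniformOfFintype _, rfl⟩

/-- The files are independent of the queries and the answer is a function of query and files, so the
law of the single query determines the triple. -/
theorem isPrivate_of_map_queryLaw
    (h : ∀ (i : V) (θ θ' : G.edgeSet),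
      (S.queryLaw θ).map (fun Q => Q i) = (S.queryLaw θ').map fun Q => Q i) : S.Private := by
  have key : ∀ (i : V) (θ : G.edgeSet),
      (S.law θ).map (fun ω => (S.queries ω i, S.answer i ω, S.stored i ω)) =
        ((S.queryLaw θ).map fun Q => Q i).bind fun q =>
          (PMF.uniformOfFintype (Contents G F S.L)).map fun W =>
            (q, evalQuery q W, fun e => W e.1) := by
    intro i θ
    rw [map_law, PMF.bind_map]
    rfl
  intro i θ θ'
  rw [key, key, h i θ θ']

/-- If the sum of all answers is a nonzero multiple of the desired file, then the file is
determined by answers and queries. -/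
theorem reliable_of_sum_answer (hm : ∀ i, S.numSums i = S.L)
    (h : ∀ θ, ∀ Q ∈ (S.queryLaw θ).support, ∃ s : F, s ≠ 0 ∧ ∀ W l,
      ∑ i, S.answer i (Q, W) (Fin.cast (hm i).symm l) = s * W θ l) : S.Reliable := by
  intro θ
  refine condEntropyOf_eq_zero _ _ _ _ ?_
  rintro ⟨Q, W⟩ hω ⟨Q', W'⟩ - heq
  obtain ⟨hans, hQ⟩ := Prod.ext_iff.1 heq
  obtain rfl : Q = Q' := hQ
  obtain ⟨s, hs, hsum⟩ := h θ Q ((S.mem_support_law θ _).1 hω)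
  funext l
  refine mul_left_cancel₀ hs ?_
  change s * W θ l = s * W' θ l
  rw [← hsum, ← hsum]
  refine Finset.sum_congr rfl fun i _ => ?_
  exact congrFun (congrFun hans i) _

/-- Excludes a zero denominator in the rate. The sum of answers is not constant in the files, so
some answer takes two values. -/
theorem sum_entropyOf_answer_pos (θ : G.edgeSet) (hm : ∀ i, S.numSums i = S.L)
    (h : ∀ Q ∈ (S.queryLaw θ).support, ∃ s : F, s ≠ 0 ∧ ∀ W l,
      ∑ i, S.answer i (Q, W) (Fin.cast (hm i).symm l) = s * W θ l) :
    0 < ∑ i, entropyOf S.base (S.law θ) (S.answer i) := by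
  have hb : 1 < S.base := S.one_lt_base
  obtain ⟨Q, hQ⟩ := (S.queryLaw θ).support_nonempty
  obtain ⟨s, hs, hsum⟩ := h Q hQ
  have hne : ∑ i, S.answer i (Q, fun _ _ => 1) (Fin.cast (hm i).symm ⟨0, S.L_pos⟩) ≠ 0 := by
    rw [hsum, mul_one]
    exact hs
  obtain ⟨i, -, hi⟩ := Finset.exists_ne_zero_of_sum_ne_zero hne
  refine Finset.sum_pos' (fun j _ => shannonEntropy_nonneg hb _) ⟨i, Finset.mem_univ i, ?_⟩
  have hmem : ∀ W, S.answer i (Q, W) ∈ ((S.law θ).map (S.answer i)).support := fun W =>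
    (PMF.mem_support_map_iff _ _ _).2 ⟨(Q, W), (S.mem_support_law θ _).2 hQ, rfl⟩
  refine shannonEntropy_pos hb _ ?_ (hmem fun _ _ => 1) (hmem fun _ _ => 0)
  intro h01
  refine hi ?_
  rw [h01]
  simp [answer, stored]

/-- A server that answers zero with probability at least `1 / 4` sends at most `3 / 4` of the
entropy of its answer space, up to a constant. -/
theorem entropyOf_answer_le (θ : G.edgeSet) (i : V)
    (h0 : 4⁻¹ ≤ (S.law θ).map (S.answer i) 0) :
    entropyOf S.base (S.law θ) (S.answer i) ≤ 3 / 4 * S.numSums i + 2 := by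
  have hF : 2 ≤ Fintype.card F := Fintype.one_lt_card
  have hF' : (2 : ℝ) ≤ S.base := by
    rw [base]
    exact_mod_cast hF
  have hb : 1 < S.base := S.one_lt_base
  have hlog : 0 < Real.log S.base := Real.log_pos hb
  refine (shannonEntropy_le hb _ 0).trans ?_
  have h4 : (4⁻¹ : ℝ) ≤ ((S.law θ).map (S.answer i) 0).toReal := by
    have := ENNReal.toReal_mono (PMF.apply_ne_top _ _) h0
    rwa [ENNReal.toReal_inv, ENNReal.toReal_ofNat] at this
  have hcard : Real.log (Fintype.card (Fin (S.numSums i) → F)) =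
      S.numSums i * Real.log S.base := by
    simp [base]
  rw [div_le_iff₀ hlog, hcard]
  -- Since `|F| ≥ 2` and `log 2 > 1/2`, the additive 1 costs at most 2 symbols.
  have h2 : (1 : ℝ) ≤ 2 * Real.log S.base := by
    have := Real.log_le_log (by norm_num) hF'
    have := Real.log_two_gt_d9
    linarith
  have h5 : (1 - ((S.law θ).map (S.answer i) 0).toReal) * (S.numSums i * Real.log S.base) ≤
      3 / 4 * (S.numSums i * Real.log S.base) :=
    mul_le_mul_of_nonneg_right (by linarith) (by positivity)
  linarith

end Scheme

/-! ### Signed queries and cancellation -/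

variable (F) in
/-- Signs that are opposite at the two ends of an edge. -/
noncomputable def endSign (e : Sym2 V) (i : V) : F := if i = (Quot.out e).1 then 1 else -1

theorem endSign_add {i j : V} (hij : i ≠ j) : endSign F s(i, j) i + endSign F s(i, j) j = 0 := by
  have h : s((Quot.out s(i, j)).1, (Quot.out s(i, j)).2) = s(i, j) := Quot.out_eq _
  rcases Sym2.eq_iff.1 h with ⟨h, -⟩ | ⟨h, -⟩ <;> simp [endSign, h, hij, hij.symm]

theorem endSign_ne_zero (e : Sym2 V) (i : V) : endSign F e i ≠ 0 := by
  rw [endSign]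
  split_ifs <;> simp

open Classical in
variable (F) in
/-- The coefficient of the file `e` in the query to server `i` with view `o`. -/
noncomputable def coeff (i : V) (o : Option (V → Bool)) (e : Sym2 V) : F :=
  if ∃ T, o = some T ∧ ∃ j, T j = true ∧ e = s(i, j) then endSign F e i else 0

open Classical in
theorem coeff_view (u v : V) (ω : Seed V) (i j : V) :
    coeff F i (view u v i ω) s(i, j) = if asks u v ω i j then endSign F s(i, j) i else 0 := by
  refine if_congr ?_ rfl rfl
  simp only [asks, Sym2.congr_right, exists_eq_right']

variable (G F) in
/-- The query with view `o`: the same combination of files for each of the `L` sub-files. -/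
noncomputable def viewQuery (L : ℕ) (i : V) (o : Option (V → Bool)) : Query G F L L i :=
  fun r e l => if r = l then coeff F i o e.1 else 0

theorem evalQuery_viewQuery {L : ℕ} (i : V) (o : Option (V → Bool)) (W : Contents G F L)
    (r : Fin L) : evalQuery (viewQuery G F L i o) W r =
      ∑ e : StoredFile G i, coeff F i o e.1 * W e.1 r := by
  simp [evalQuery, viewQuery]

theorem evalQuery_viewQuery_none {L : ℕ} (i : V) (W : Contents G F L) :
    evalQuery (viewQuery G F L i none) W = 0 := by
  funext r
  simp [evalQuery_viewQuery, coeff]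

/-- A sum over all files on all servers, arranged by files. -/
theorem sum_sum_storedFile (f : V → G.edgeSet → F) :
    ∑ i, ∑ e : StoredFile G i, f i e.1 =
      ∑ e : G.edgeSet, ∑ i ∈ Finset.univ.filter (fun i => i ∈ (e : Sym2 V)), f i e := by
  simp only [Finset.sum_filter]
  rw [Finset.sum_comm]
  refine Finset.sum_congr rfl fun i _ => ?_
  rw [← Finset.sum_filter]
  exact (Finset.sum_subtype _ (by simp) _).symm

theorem sum_coeff_view {u v i j : V} (ω : Seed V) (hij : i ≠ j) :
    ∑ k ∈ Finset.univ.filter (fun k => k ∈ s(i, j)), coeff F k (view u v k ω) s(i, j) =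
      coeff F i (view u v i ω) s(i, j) + coeff F j (view u v j ω) s(i, j) := by
  rw [← Finset.sum_pair (f := fun k => coeff F k (view u v k ω) s(i, j)) hij]
  congr 1
  ext k
  simp

/-- The two ends are asked simultaneously and carry opposite signs. -/
theorem sum_coeff_view_of_ne {u v : V} (huv : u ≠ v) (ω : Seed V) (e : G.edgeSet)
    (he : (e : Sym2 V) ≠ s(u, v)) :
    ∑ k ∈ Finset.univ.filter (fun k => k ∈ (e : Sym2 V)), coeff F k (view u v k ω) e = 0 := by
  obtain ⟨e, hG⟩ := e
  induction e using Sym2.ind with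
  | _ i j =>
    have hij : i ≠ j := G.ne_of_adj hG
    rw [sum_coeff_view ω hij, coeff_view, Sym2.eq_swap, coeff_view, ← asks_comm huv ω hij he,
      Sym2.eq_swap]
    split_ifs
    · exact endSign_add hij
    · simp

/-- Exactly one end is asked, so a single sign survives. -/
theorem sum_coeff_view_self {u v : V} (huv : u ≠ v) (ω : Seed V) :
    ∑ k ∈ Finset.univ.filter (fun k => k ∈ s(u, v)), coeff F k (view u v k ω) s(u, v) ≠ 0 := by
  rw [sum_coeff_view ω huv, coeff_view, Sym2.eq_swap, coeff_view, asks_endpoint_iff huv]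
  split_ifs
  · simpa using endSign_ne_zero _ _
  · simpa using endSign_ne_zero _ _

theorem exists_sum_evalQuery_eq {L : ℕ} {u v : V} (ω : Seed V) (θ : G.edgeSet)
    (hθ : s(u, v) = θ) :
    ∃ s : F, s ≠ 0 ∧ ∀ (W : Contents G F L) (l : Fin L),
      ∑ i, evalQuery (viewQuery G F L i (view u v i ω)) W l = s * W θ l := by
  have huv : u ≠ v := G.ne_of_adj (a := u) (b := v) (by
    have := θ.2
    rwa [← hθ] at this)
  refine ⟨_, sum_coeff_view_self huv ω, fun W l => ?_⟩
  simp only [evalQuery_viewQuery]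
  rw [sum_sum_storedFile (fun i e => coeff F i (view u v i ω) e * W e l),
    Finset.sum_eq_single θ, ← Finset.sum_mul, hθ]
  · intro e _ he
    rw [← Finset.sum_mul, sum_coeff_view_of_ne huv ω e, zero_mul]
    rw [hθ]
    exact fun h => he (Subtype.ext h)
  · simp

/-! ### The scheme, its rate and the limit in L -/

variable (G F) in
/-- The scheme that contracts the desired edge to draw the queries. -/
noncomputable def contractionScheme (L : ℕ) (hL : 0 < L) : Scheme G F where
  L := L
  L_pos := hL
  numSums _ := L
  queryLaw θ := (PMF.uniformOfFintype (Seed V)).map fun ω i =>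
    viewQuery G F L i (view (Quot.out θ.1).1 (Quot.out θ.1).2 i ω)

theorem out_fst_ne_snd (θ : G.edgeSet) : (Quot.out θ.1).1 ≠ (Quot.out θ.1).2 := by
  refine G.ne_of_adj ?_
  have h : s((Quot.out θ.1).1, (Quot.out θ.1).2) = θ.1 := Quot.out_eq _
  have := θ.2
  rwa [← h] at this

theorem map_queryLaw_contractionScheme {L : ℕ} (hL : 0 < L) (θ : G.edgeSet) (i : V) :
    ((contractionScheme G F L hL).queryLaw θ).map (fun Q => Q i) =
      ((PMF.uniformOfFintype (Seed V)).map
        (view (Quot.out θ.1).1 (Quot.out θ.1).2 i)).map (viewQuery G F L i) := by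
  simp only [contractionScheme, PMF.map_comp]
  rfl

theorem exists_sum_answer_contractionScheme {L : ℕ} (hL : 0 < L) (θ : G.edgeSet) :
    ∀ Q ∈ ((contractionScheme G F L hL).queryLaw θ).support, ∃ s : F, s ≠ 0 ∧ ∀ W l,
      ∑ i, (contractionScheme G F L hL).answer i (Q, W) (Fin.cast rfl l) = s * W θ l := by
  intro Q hQ
  obtain ⟨ω, -, rfl⟩ := (PMF.mem_support_map_iff _ _ _).1 hQ
  exact exists_sum_evalQuery_eq (L := L) ω θ (Quot.out_eq _)

theorem isPIR_contractionScheme {L : ℕ} (hL : 0 < L) : (contractionScheme G F L hL).IsPIR where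
  reliable := Scheme.reliable_of_sum_answer _ (fun _ => rfl)
    (exists_sum_answer_contractionScheme hL)
  isPrivate := by
    refine Scheme.isPrivate_of_map_queryLaw _ fun i θ θ' => ?_
    rw [map_queryLaw_contractionScheme, map_queryLaw_contractionScheme]
    congr 1
    ext o
    rw [map_view_apply (out_fst_ne_snd θ), map_view_apply (out_fst_ne_snd θ')]

theorem map_answer_zero_contractionScheme {L : ℕ} (hL : 0 < L) (θ : G.edgeSet) (i : V) :
    4⁻¹ ≤ ((contractionScheme G F L hL).law θ).map ((contractionScheme G F L hL).answer i) 0 := by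
  have h : ((contractionScheme G F L hL).law θ).map ((contractionScheme G F L hL).answer i) =
      ((PMF.uniformOfFintype (Seed V)).map (view (Quot.out θ.1).1 (Quot.out θ.1).2 i)).bind
        fun o => (PMF.uniformOfFintype (Contents G F L)).map (evalQuery (viewQuery G F L i o)) := by
    rw [Scheme.map_law, PMF.bind_map]
    simp only [contractionScheme]
    rw [PMF.bind_map]
    rfl
  rw [h]
  change 4⁻¹ ≤ PMF.bind _ _ (0 : Fin L → F)
  rw [PMF.bind_apply]
  -- The unused view alone contributes mass 1/4 to the zero answer.
  refine le_trans ?_ (ENNReal.le_tsum none)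
  rw [map_view_none (out_fst_ne_snd θ)]
  have hzero : evalQuery (viewQuery G F L i none) =
      Function.const (Contents G F L) (0 : Fin L → F) := funext (evalQuery_viewQuery_none i)
  rw [hzero, PMF.map_const, PMF.pure_apply_self, mul_one]

theorem rate_contractionScheme_ge {L : ℕ} (hL : 0 < L) (θ : G.edgeSet) :
    (L : ℝ) / (Fintype.card V * (3 / 4 * L + 2)) ≤ (contractionScheme G F L hL).rate θ := by
  have hpos := Scheme.sum_entropyOf_answer_pos _ θ (fun _ => rfl)
    (exists_sum_answer_contractionScheme (F := F) hL θ)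
  refine div_le_div_of_nonneg_left (Nat.cast_nonneg L) hpos ?_
  refine (Finset.sum_le_card_nsmul _ _ (3 / 4 * (L : ℝ) + 2) fun i _ => Scheme.entropyOf_answer_le _ θ i
    (map_answer_zero_contractionScheme (F := F) hL θ i)).trans ?_
  rw [nsmul_eq_mul, Finset.card_univ]

/-- Any graph allows retrieval at rate `4 / 3` divided by the number of servers. -/
theorem four_thirds_le_capacity (G : SimpleGraph V) [DecidableRel G.Adj] :
    ((4 / 3 * (1 / (Fintype.card V : ℝ)) : ℝ) : EReal) ≤ capacity G F := by
  have hle : ∀ n : ℕ, (((n + 1 : ℕ) / (Fintype.card V * (3 / 4 * (n + 1 : ℕ) + 2)) : ℝ) : EReal) ≤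
      capacity G F := fun n =>
    le_iSup₂_of_le (contractionScheme G F (n + 1) n.succ_pos)
      (isPIR_contractionScheme n.succ_pos)
      (le_iInf fun θ => EReal.coe_le_coe_iff.2 (rate_contractionScheme_ge n.succ_pos θ))
  have hlim : Filter.Tendsto (fun x : ℝ => (3 / 4 + 2 * x⁻¹)⁻¹ * (1 / (Fintype.card V : ℝ)))
      Filter.atTop (nhds ((3 / 4 + 2 * 0)⁻¹ * (1 / (Fintype.card V : ℝ)))) :=
    (((tendsto_inv_atTop_zero.const_mul 2).const_add (3 / 4)).inv₀ (by norm_num)).mul_const _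
  have hnat := hlim.comp (tendsto_natCast_atTop_atTop.comp (Filter.tendsto_add_atTop_nat 1))
  rw [show ((3 / 4 + 2 * 0 : ℝ)⁻¹) = 4 / 3 by norm_num] at hnat
  refine le_of_tendsto' ((continuous_coe_real_ereal.tendsto _).comp hnat) fun n => ?_
  refine le_trans (le_of_eq ?_) (hle n)
  simp only [Function.comp_apply, EReal.coe_eq_coe_iff]
  have : ((n + 1 : ℕ) : ℝ) ≠ 0 := by positivity
  rw [div_mul_eq_div_div_swap, div_eq_mul_inv (_ / _) (Fintype.card V : ℝ), one_div]
  congr 1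
  field_simp

end Protocol

end GraphPIR

theorem mainTheorem3 :
    ∃ ε : ℕ → ℝ, Filter.Tendsto ε Filter.atTop (nhds 0) ∧
      ∀ N : ℕ, 3 ≤ N →
        ∀ (F : Type*) [Field F] [Fintype F],
          (((4 / 3 - ε N) * (1 / (N : ℝ)) : ℝ) : EReal) ≤
            GraphPIR.capacity (⊤ : SimpleGraph (Fin N)) F := by
  -- The bound 4/(3N) is reached in the supremum, so no error term is needed.
  refine ⟨fun _ => 0, tendsto_const_nhds, fun N _ F _ _ => ?_⟩
  have h := GraphPIR.four_thirds_le_capacity (F := F) (⊤ : SimpleGraph (Fin N))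
  rw [Fintype.card_fin] at h
  rwa [sub_zero]
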